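/- Terms are built from function symbols of a signature $\mathcal F$ and variables of a set $\mathcal V$. Let $\mathcal R$ be a term rewrite system: a finite set of rules $l\to r$ over these terms with $l\notin\mathcal V$ and $\mathrm{Var}(r)\subseteq \mathrm{Var}(l)$. Let $\mathcal D$ be the set of its defined symbols (roots of left-hand sides). A term $f(t_1,\dots,t_n)$ is basic if $f\in\mathcal D$ and no $t_i$ contains a symbol of $\mathcal D$. Let $\to_{\mathcal S}$ denote, throughout, either the rewrite relation of a rule set $\mathcal S$ (full case) or its innermost rewrite relation, in which all proper subterms of the contracted redex are normal forms of $\mathcal S$ (innermost case). The derivation height $\mathrm{dh}(t,\to)\in\mathbb N\cup\{\infty\}$ is the supremum of the lengths of $\to$-derivations starting in $t$. For a term $t=f(t_1,\dots,t_n)$ let $t^\sharp=f^\sharp(t_1,\dots,t_n)$ with a fresh symbol $f^\sharp$, and let $x^\sharp=x$ for variables. For each rule $l\to r\in\mathcal R$ write $r=C[u_1,\dots,u_n]$, where the roots of the $u_i$ are in $X$ and $C$ contains no element of $X$, with $X=\mathcal D\cup\mathcal V$ in the full case and $X=\mathcal D$ in the innermost case. The weak (innermost) dependency pair of the rule is $l^\sharp\to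 u_1^\sharp$ if $n=1$, and $l^\sharp\to c(u_1^\sharp,\dots,u_n^\sharp)$ with a fresh $n$-ary compound symbol $c$ otherwise. Let $\mathcal P$ be the set of these pairs. For $\mathcal Q\subseteq\mathcal P$ the usable rules $\mathcal U(\mathcal Q)$ are the rules $l\to r\in\mathcal R$ such that the root of $l$ is reachable from a symbol $f \in \mathcal F$ occurring in the right-hand side of a pair of $\mathcal Q$ by finitely many (possibly zero) steps $f\rhd g$, where $f\rhd g$ means that some rule of $\mathcal R$ has a left-hand side with root $f$ and a right-hand side containing $g\in\mathcal D$. The weak (innermost) dependency graph has the set of nodes $\mathcal P$ and an edge from $s\to t$ to $u\to v$ iff $t\sigma\to_{\mathcal R}^* C[u\tau]$ for some context $C$ and some substitutions $\sigma,\tau$ from variables to terms over $\mathcal F$ and $\mathcal V$. The nodes of its congruence graph are its strongly connected components, with an edge from $\mathcal K$ to $\mathcal L$ if $\mathcal K\neq\mathcal L$ and some edge leads from an element of $\mathcal K$ to an element of $\mathcal L$; a source node is one without incoming edges. For a term $s$ put $$\mathrm{Path}(s)=\sup\{\mathrm{dh}(s,\to_{\mathcal Q\cup\,\mathcal U(\mathcal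 Q)}) \mid (\mathcal P_1,\dots,\mathcal P_k)\text{ is a path in the congruence graph, } \mathcal P_1\text{ is a source node, }\mathcal Q=\mathcal P_1\cup\dots\cup\mathcal P_k\}\in\mathbb N\cup\{\infty\}.$$ Theorem. In the full and in the innermost case, $\mathrm{dh}(t,\to_{\mathcal R})=O(\mathrm{Path}(t^\sharp))$ for basic terms $t$: there is a constant $c\in\mathbb N$, depending only on $\mathcal R$ (and on the case), such that $\mathrm{dh}(t,\to_{\mathcal R})\le c\cdot \mathrm{Path}(t^\sharp)$ for every basic term $t$. -/

import Mathlib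

universe u v w

namespace TermRewriting

noncomputable section

/-- Signatures are first-order languages (their relation symbols play no role) and terms over the
signature `L` and the variables `V` are `L.Term V`. A function symbol together with its arity. -/
abbrev Sym (L : FirstOrder.Language.{u, v}) : Type u := Σ n : ℕ, L.Functions n

/-- A pair of terms `lhs → rhs`. -/
structure Rule (L : FirstOrder.Language.{u, v}) (V : Type w) where
  lhs : L.Term V
  rhs : L.Term V

section Terms

variable {L : FirstOrder.Language.{u, v}} {V : Type w}

/-- The set of function symbols that occur in a term. -/
def funs : L.Term V → Set (Sym L)
  | .var _ => ∅
  | .func (l := n) f ts => {⟨n, f⟩} ∪ ⋃ i, funs (ts i)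

/-- The set of variables that occur in a term. -/
def vars : L.Term V → Set V
  | .var x => {x}
  | .func _ ts => ⋃ i, vars (ts i)

/-- `HasRoot t f`: the root symbol of `t` is the function symbol `f`. -/
def HasRoot : L.Term V → Sym L → Prop
  | .var _, _ => False
  | .func (l := n) f _, g => g = ⟨n, f⟩

/-- One-hole contexts. In `arg f i ts C` the hole is in the `i`-th argument, the term `ts i` is
ignored. -/
inductive Ctx (L : FirstOrder.Language.{u, v}) (V : Type w) : Type (max u w)
  | hole : Ctx L V
  | arg {n : ℕ} (f : L.Functions n) (i : Fin n) (ts : Fin n → L.Term V) (C : Ctx L V) : Ctx L V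

/-- `C.fill t` is `C[t]`. -/
def Ctx.fill : Ctx L V → L.Term V → L.Term V
  | .hole, t => t
  | .arg f i ts C, t => .func f (Function.update ts i (C.fill t))

/-- `u` is a proper subterm of `t`. -/
def ProperSubterm (u t : L.Term V) : Prop :=
  ∃ C : Ctx L V, C ≠ Ctx.hole ∧ t = C.fill u

/-- `R` is a term rewrite system. -/
structure IsTRS (R : Set (Rule L V)) : Prop where
  finite : R.Finite
  lhs_ne_var : ∀ ρ ∈ R, ∀ x : V, ρ.lhs ≠ .var x
  vars_subset : ∀ ρ ∈ R, vars ρ.rhs ⊆ vars ρ.lhs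

/-- The rewrite relation of `R`. -/
def Step (R : Set (Rule L V)) (s t : L.Term V) : Prop :=
  ∃ ρ ∈ R, ∃ (C : Ctx L V) (σ : V → L.Term V),
    s = C.fill (ρ.lhs.subst σ) ∧ t = C.fill (ρ.rhs.subst σ)

/-- `t` is a normal form of `R`. -/
def NormalForm (R : Set (Rule L V)) (t : L.Term V) : Prop := ∀ u, ¬ Step R t u

/-- The innermost rewrite relation of `R`. -/
def InnermostStep (R : Set (Rule L V)) (s t : L.Term V) : Prop :=
  ∃ ρ ∈ R, ∃ (C : Ctx L V) (σ : V → L.Term V),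
    s = C.fill (ρ.lhs.subst σ) ∧ t = C.fill (ρ.rhs.subst σ) ∧
      ∀ u, ProperSubterm u (ρ.lhs.subst σ) → NormalForm R u

/-- The two settings: full rewriting and innermost rewriting. -/
inductive Mode
  | full
  | innermost

/-- The rewrite relation of `R` in the given setting. -/
def Rew : Mode → Set (Rule L V) → L.Term V → L.Term V → Prop
  | .full, R => Step R
  | .innermost, R => InnermostStep R

/-- The defined symbols of `R`: the roots of left-hand sides. -/
def defined (R : Set (Rule L V)) : Set (Sym L) := {f | ∃ ρ ∈ R, HasRoot ρ.lhs f}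

/-- Basic terms: a defined symbol applied to terms over constructors and variables. -/
def IsBasic (R : Set (Rule L V)) : L.Term V → Prop
  | .var _ => False
  | .func (l := n) f ts =>
      (⟨n, f⟩ : Sym L) ∈ defined R ∧ ∀ i, ∀ g ∈ funs (ts i), g ∉ defined R

end Terms

section Height

variable {α : Type w}

/-- `StepsN r n a b`: exactly `n` steps of `r` lead from `a` to `b`. -/
def StepsN (r : α → α → Prop) : ℕ → α → α → Prop
  | 0, a, b => a = b
  | n + 1, a, b => ∃ c, r a c ∧ StepsN r n c b

/-- The derivation height of `a` with respect to `r`: the supremum of the lengths of derivations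
that start in `a` (the maximum, if there is one, and `⊤` if there are arbitrarily long ones). -/
def dheight (r : α → α → Prop) (a : α) : ℕ∞ :=
  ⨆ (n : ℕ) (_ : ∃ b, StepsN r n a b), (n : ℕ∞)

end Height

section DependencyPairs

/-- The function symbols of the extended signature: those of `L`, a dependency pair symbol `f♯` for
each `f` in `L`, and fresh compound symbols of each arity for every rule. -/
inductive SharpFun (L : FirstOrder.Language.{u, v}) (V : Type w) : ℕ → Type (max u w)
  | base {n : ℕ} (f : L.Functions n) : SharpFun L V n
  | dp {n : ℕ} (f : L.Functions n) : SharpFun L V n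
  | compound (ρ : Rule L V) (n : ℕ) : SharpFun L V n

/-- The extended signature. -/
def sharpLang (L : FirstOrder.Language.{u, v}) (V : Type w) : FirstOrder.Language.{max u w, v} where
  Functions := SharpFun L V
  Relations := L.Relations

variable {L : FirstOrder.Language.{u, v}} {V : Type w}

/-- The symbol `f` as a symbol of the extended signature. -/
def baseSym (f : Sym L) : Sym (sharpLang L V) := ⟨f.1, SharpFun.base f.2⟩

/-- Terms over `L` as terms over the extended signature. -/
def embed : L.Term V → (sharpLang L V).Term V
  | .var x => .var x
  | .func (l := n) f ts =>
      .func (L := sharpLang L V) (l := n) (SharpFun.base f) (fun i => embed (ts i))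

/-- Rules over `L` as rules over the extended signature. -/
def embedRule (ρ : Rule L V) : Rule (sharpLang L V) V := ⟨embed ρ.lhs, embed ρ.rhs⟩

/-- `t♯`. -/
def sharp : L.Term V → (sharpLang L V).Term V
  | .var x => .var x
  | .func (l := n) f ts =>
      .func (L := sharpLang L V) (l := n) (SharpFun.dp f) (fun i => embed (ts i))

open Classical in
/-- For the unique decomposition `t = C⟨t₁, …, tₙ⟩_X`, where `C` contains no symbol of `X` and the
roots of the `tᵢ` are in `X`, the list `t₁, …, tₙ`. Here `X = D ∪ V` for full rewriting and `X = D`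
for innermost rewriting. -/
def maxSubterms (m : Mode) (D : Set (Sym L)) : L.Term V → List (L.Term V)
  | .var x =>
      match m with
      | .full => [.var x]
      | .innermost => []
  | .func (l := n) f ts =>
      if (⟨n, f⟩ : Sym L) ∈ D then [.func f ts]
      else (List.ofFn fun i => maxSubterms m D (ts i)).flatten

/-- `COM(t₁, …, tₙ)`: the term `t₁` if `n = 1`, and `c(t₁, …, tₙ)` with the compound symbol `c` that
belongs to the rule `ρ` otherwise. -/
def com (ρ : Rule L V) : List ((sharpLang L V).Term V) → (sharpLang L V).Term V
  | [t] => t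
  | ts => .func (L := sharpLang L V) (l := ts.length) (SharpFun.compound ρ ts.length) ts.get

/-- The weak (innermost) dependency pair of the rule `ρ` of `R`. -/
def depPair (m : Mode) (R : Set (Rule L V)) (ρ : Rule L V) : Rule (sharpLang L V) V :=
  ⟨sharp ρ.lhs, com ρ ((maxSubterms m (defined R) ρ.rhs).map sharp)⟩

/-- The set of weak dependency pairs, respectively weak innermost dependency pairs, of `R`. -/
def weakPairs (m : Mode) (R : Set (Rule L V)) : Set (Rule (sharpLang L V) V) :=
  depPair m R '' R

/-- `f ⊳ g`: there is a rule whose left-hand side has the root `f` and whose right-hand side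
contains the defined symbol `g`. -/
def DependsOn (R : Set (Rule L V)) (f g : Sym L) : Prop :=
  ∃ ρ ∈ R, HasRoot ρ.lhs f ∧ g ∈ defined R ∧ g ∈ funs ρ.rhs

/-- The usable rules `U(t)` of a term `t` over the extended signature. -/
def usableTerm (R : Set (Rule L V)) (t : (sharpLang L V).Term V) : Set (Rule L V) :=
  {ρ ∈ R | ∃ f g : Sym L, baseSym f ∈ funs t ∧ Relation.ReflTransGen (DependsOn R) f g ∧
    HasRoot ρ.lhs g}

/-- The usable rules `U(Q)` of a set of pairs, as rules over the extended signature. -/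
def usable (R : Set (Rule L V)) (Q : Set (Rule (sharpLang L V) V)) :
    Set (Rule (sharpLang L V) V) :=
  embedRule '' ⋃ p ∈ Q, usableTerm R p.rhs

end DependencyPairs

section Graphs

variable {L : FirstOrder.Language.{u, v}} {V : Type w}

/-- The edges of the weak (innermost) dependency graph: there is one from `s → t` to `u → v` iff
`tσ` rewrites with `R` to `C[uτ]` for some context `C` and some substitutions `σ`, `τ` whose values
are terms over the original signature. -/
def GraphEdge (m : Mode) (R : Set (Rule L V)) (p q : Rule (sharpLang L V) V) : Prop :=
  p ∈ weakPairs m R ∧ q ∈ weakPairs m R ∧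
    ∃ (C : Ctx (sharpLang L V) V) (σ τ : V → L.Term V),
      Relation.ReflTransGen (Rew m (embedRule '' R))
        (p.rhs.subst fun x => embed (σ x)) (C.fill (q.lhs.subst fun x => embed (τ x)))

/-- The nodes of the congruence graph: the strongly connected components of the weak (innermost)
dependency graph, as sets of pairs. -/
def CongNode (m : Mode) (R : Set (Rule L V)) (K : Set (Rule (sharpLang L V) V)) : Prop :=
  ∃ p ∈ weakPairs m R, K = {q | Relation.ReflTransGen (GraphEdge m R) p q ∧
    Relation.ReflTransGen (GraphEdge m R) q p}

/-- The edges of the congruence graph, between different nodes. -/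
def CongEdge (m : Mode) (R : Set (Rule L V)) (K M : Set (Rule (sharpLang L V) V)) : Prop :=
  CongNode m R K ∧ CongNode m R M ∧ K ≠ M ∧ ∃ p ∈ K, ∃ q ∈ M, GraphEdge m R p q

/-- The source nodes of the congruence graph: those without incoming edges. -/
def IsSource (m : Mode) (R : Set (Rule L V)) (K : Set (Rule (sharpLang L V) V)) : Prop :=
  CongNode m R K ∧ ∀ M, ¬ CongEdge m R M K

/-- The sequence `K, Ks` is a path in the congruence graph that starts in a source node. -/
def IsSourcePath (m : Mode) (R : Set (Rule L V)) (K : Set (Rule (sharpLang L V) V))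
    (Ks : List (Set (Rule (sharpLang L V) V))) : Prop :=
  IsSource m R K ∧ List.IsChain (CongEdge m R) (K :: Ks)

/-- The union `Q` of the nodes of a path. -/
def pathPairs (Ks : List (Set (Rule (sharpLang L V) V))) : Set (Rule (sharpLang L V) V) :=
  {p | ∃ K ∈ Ks, p ∈ K}

/-- `Path(t)`: the maximal derivation height of `t` with respect to `Q ∪ U(Q)`, where `Q` is the
union of the nodes of a path that starts in a source node. -/
def pathHeight (m : Mode) (R : Set (Rule L V)) (t : (sharpLang L V).Term V) : ℕ∞ :=
  ⨆ (K : Set (Rule (sharpLang L V) V)) (Ks : List (Set (Rule (sharpLang L V) V)))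
    (_ : IsSourcePath m R K Ks),
    dheight (Rew m (pathPairs (K :: Ks) ∪ usable R (pathPairs (K :: Ks)))) t

end Graphs

end

end TermRewriting

/-! A derivation from a basic term is imitated on the sharped term. A step below the root becomes a
step with a usable rule, a root step becomes a step with the weak dependency pair of the rule. After
a root step the constructor context of the right-hand side is inert, so the rest of the derivation
splits into independent derivations from instances of the maximal subterms (`le_sum_maxSubterms`),
and these are the components of the right-hand side of the pair. In the innermost case variables may
be dropped, as they are instantiated by normal forms.

The pairs used along one branch of this recursion follow edges of the dependency graph, so they lie
on one path of the congruence graph; different branches may need different paths. Hence for each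
path union `Q` only those steps are kept whose history, the set of pairs used so far on the branch,
is contained in `Q`. The kept steps form a derivation with `Q` and its usable rules, because lengths
add up below a compound symbol (`stepsN_com`). Every step is kept for at least one `Q`, so the
lengths for all `Q` sum to at least the original length. This is `exists_simulation`; its paths come
from `exists_pathTo` and `PathTo.exists_of_edge`. The constant is the number of path unions. -/

namespace TermRewriting

/-! ### Lengths of derivations. -/

section Derivations

variable {α : Type*}

theorem StepsN.trans {r : α → α → Prop} {n k : ℕ} {a b c : α} (h : StepsN r n a b)
    (h' : StepsN r k b c) : StepsN r (n + k) a c := by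
  induction n generalizing a with
  | zero => cases h; simpa using h'
  | succ n ih =>
    obtain ⟨d, hd, h⟩ := h
    rw [Nat.add_right_comm]
    exact ⟨d, hd, ih h⟩

theorem StepsN.le_dheight {r : α → α → Prop} {n : ℕ} {a b : α} (h : StepsN r n a b) :
    (n : ℕ∞) ≤ dheight r a :=
  le_iSup₂_of_le (f := fun (n : ℕ) (_ : ∃ b, StepsN r n a b) => (n : ℕ∞)) n ⟨b, h⟩ le_rfl

theorem StepsN.map {β : Type*} {r : α → α → Prop} {r' : β → β → Prop} {F : α → β}
    (hF : ∀ a b, r a b → r' (F a) (F b)) {n : ℕ} {a b : α} (h : StepsN r n a b) :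
    StepsN r' n (F a) (F b) := by
  induction n generalizing a with
  | zero => cases h; rfl
  | succ n ih =>
    obtain ⟨d, hd, h⟩ := h
    exact ⟨F d, hF _ _ hd, ih h⟩

end Derivations

/-! ### Rewriting in contexts and arguments; symbols and variables under substitution. -/

section Terms

variable {L : FirstOrder.Language.{u, v}} {V : Type w}

theorem Rew.toStep {m : Mode} {S : Set (Rule L V)} {s t : L.Term V} (h : Rew m S s t) :
    Step S s t := by
  cases m with
  | full => exact h
  | innermost =>
    obtain ⟨ρ, hρ, C, σ, h1, h2, -⟩ := h
    exact ⟨ρ, hρ, C, σ, h1, h2⟩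

/-- The redexes that may be contracted in the given setting. -/
def Mode.Admissible (m : Mode) (S : Set (Rule L V)) (s : L.Term V) : Prop :=
  m = .innermost → ∀ u, ProperSubterm u s → NormalForm S u

theorem rew_iff {m : Mode} {S : Set (Rule L V)} {s t : L.Term V} :
    Rew m S s t ↔ ∃ ρ ∈ S, ∃ (C : Ctx L V) (σ : V → L.Term V),
      s = C.fill (ρ.lhs.subst σ) ∧ t = C.fill (ρ.rhs.subst σ) ∧
        m.Admissible S (ρ.lhs.subst σ) := by
  cases m <;> simp [Rew, Step, InnermostStep, Mode.Admissible]

theorem Rew.arg {m : Mode} {S : Set (Rule L V)} {n : ℕ} (f : L.Functions n)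
    (ts : Fin n → L.Term V) (i : Fin n) {t : L.Term V} (h : Rew m S (ts i) t) :
    Rew m S (.func f ts) (.func f (Function.update ts i t)) := by
  rw [rew_iff] at h ⊢
  obtain ⟨ρ, hρ, C, σ, h1, rfl, h3⟩ := h
  refine ⟨ρ, hρ, .arg f i ts C, σ, ?_, rfl, h3⟩
  rw [Ctx.fill, ← h1, Function.update_eq_self]

theorem Rew.update {m : Mode} {S : Set (Rule L V)} {n : ℕ} (f : L.Functions n)
    (ts : Fin n → L.Term V) (i : Fin n) {s t : L.Term V} (h : Rew m S s t) :
    Rew m S (.func f (Function.update ts i s)) (.func f (Function.update ts i t)) := by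
  have := Rew.arg f (Function.update ts i s) i (t := t) (by simpa using h)
  simpa using this

theorem Rew.fill {m : Mode} {S : Set (Rule L V)} (C : Ctx L V) {s t : L.Term V}
    (h : Rew m S s t) : Rew m S (C.fill s) (C.fill t) := by
  induction C with
  | hole => exact h
  | arg f i ts C ih => exact Rew.update f ts i ih

/-- A step from `f(t₁, …, tₙ)` takes place in an argument or at the root. -/
theorem Rew.func_cases {m : Mode} {S : Set (Rule L V)} {n : ℕ} {f : L.Functions n}
    {ts : Fin n → L.Term V} {t : L.Term V} (h : Rew m S (.func f ts) t) :
    (∃ i t', Rew m S (ts i) t' ∧ t = .func f (Function.update ts i t')) ∨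
      ∃ ρ ∈ S, ∃ σ : V → L.Term V, .func f ts = ρ.lhs.subst σ ∧ t = ρ.rhs.subst σ ∧
        m.Admissible S (ρ.lhs.subst σ) := by
  rw [rew_iff] at h
  obtain ⟨ρ, hρ, C, σ, h1, rfl, h3⟩ := h
  cases C with
  | hole => exact .inr ⟨ρ, hρ, σ, h1, rfl, h3⟩
  | arg g i ts' C =>
    left
    rw [Ctx.fill] at h1
    cases h1
    refine ⟨i, C.fill (ρ.rhs.subst σ), ?_, by simp [Ctx.fill]⟩
    rw [rew_iff]
    exact ⟨ρ, hρ, C, σ, by simp, rfl, h3⟩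

/-- Derivations from the arguments of a term can be performed one after the other. -/
theorem stepsN_func {m : Mode} {S : Set (Rule L V)} {n : ℕ} (f : L.Functions n)
    (ts : Fin n → L.Term V) (k : Fin n → ℕ) (h : ∀ i, ∃ b, StepsN (Rew m S) (k i) (ts i) b) :
    ∃ b, StepsN (Rew m S) (∑ i, k i) (.func f ts) b := by
  have key : ∀ I : Finset (Fin n), ∃ ts' : Fin n → L.Term V, (∀ i, i ∉ I → ts' i = ts i) ∧
      StepsN (Rew m S) (∑ i ∈ I, k i) (.func f ts) (.func f ts') := by
    intro I
    induction I using Finset.induction_on with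
    | empty => exact ⟨ts, fun _ _ => rfl, rfl⟩
    | insert i I hi ih =>
      obtain ⟨ts', h1, h2⟩ := ih
      obtain ⟨b, hb⟩ := h i
      refine ⟨Function.update ts' i b, fun j hj => ?_, ?_⟩
      · rw [Finset.mem_insert, not_or] at hj
        rw [Function.update_of_ne hj.1, h1 j hj.2]
      · rw [Finset.sum_insert hi, add_comm]
        refine h2.trans ?_
        rw [← h1 i hi] at hb
        have := hb.map (r' := Rew m S) (F := fun s => .func f (Function.update ts' i s))
          fun _ _ => Rew.update f ts' i
        simpa using this
  obtain ⟨ts', -, h⟩ := key Finset.univ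
  exact ⟨_, h⟩

/-- Derivations from a term whose root is not a defined symbol are made of derivations from its
arguments. -/
theorem stepsN_func_split {m : Mode} {R : Set (Rule L V)} (hR : IsTRS R) {n k : ℕ}
    {f : L.Functions n} (hf : (⟨n, f⟩ : Sym L) ∉ defined R) {ts : Fin n → L.Term V} {b : L.Term V}
    (h : StepsN (Rew m R) k (.func f ts) b) :
    ∃ ks : Fin n → ℕ, k = ∑ i, ks i ∧ ∀ i, ∃ b, StepsN (Rew m R) (ks i) (ts i) b := by
  induction k generalizing ts with
  | zero => exact ⟨fun _ => 0, by simp, fun i => ⟨ts i, rfl⟩⟩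
  | succ k ih =>
    obtain ⟨c, hc, h⟩ := h
    obtain ⟨i, t', ht', rfl⟩ | ⟨ρ, hρ, σ, h1, -, -⟩ := hc.func_cases
    · obtain ⟨ks, hk, hks⟩ := ih h
      refine ⟨ks + Pi.single i 1, ?_, fun j => ?_⟩
      · simp [Finset.sum_add_distrib, hk]
      · obtain ⟨b, hb⟩ := hks j
        by_cases hj : j = i
        · subst hj
          exact ⟨b, by simpa using ⟨t', ht', by simpa using hb⟩⟩
        · exact ⟨b, by simpa [hj] using hb⟩
    · refine absurd ⟨ρ, hρ, ?_⟩ hf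
      cases hl : ρ.lhs with
      | var x => exact absurd hl (hR.lhs_ne_var ρ hρ x)
      | func g ss =>
        rw [hl] at h1
        cases h1
        rfl

theorem NormalForm.not_rew {m : Mode} {S : Set (Rule L V)} {s t : L.Term V}
    (hs : NormalForm S s) : ¬ Rew m S s t := fun h => hs _ h.toStep

/-- Applied to left-hand sides, which are not variables, the nontrivial context makes each `σ x` a
proper subterm of the redex, hence a normal form in the innermost case. -/
theorem exists_fill_of_mem_vars (σ : V → L.Term V) {x : V} {t : L.Term V} (hx : x ∈ vars t) :
    ∃ C : Ctx L V, t.subst σ = C.fill (σ x) ∧ ((∀ y, t ≠ .var y) → C ≠ .hole) := by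
  induction t with
  | var y =>
    cases hx
    exact ⟨.hole, rfl, fun h => absurd rfl (h x)⟩
  | func f ts ih =>
    obtain ⟨i, hi⟩ := Set.mem_iUnion.1 hx
    obtain ⟨C, hC, -⟩ := ih i hi
    refine ⟨.arg f i (fun j => (ts j).subst σ) C, ?_, fun _ => by simp⟩
    rw [Ctx.fill, ← hC]
    simp [FirstOrder.Language.Term.subst]

theorem funs_subset_funs_fill (C : Ctx L V) (s : L.Term V) : funs s ⊆ funs (C.fill s) := by
  induction C with
  | hole => exact subset_rfl
  | arg f i ts C ih =>
    refine ih.trans ?_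
    rw [Ctx.fill, funs]
    refine Set.subset_union_of_subset_right (Set.subset_iUnion_of_subset i ?_) _
    simp

theorem funs_fill_subset (C : Ctx L V) (s t : L.Term V) :
    funs (C.fill t) ⊆ funs (C.fill s) ∪ funs t := by
  induction C with
  | hole => exact Set.subset_union_right
  | arg f i ts C ih =>
    rintro g (hg | hg)
    · exact .inl (.inl hg)
    · obtain ⟨j, hj⟩ := Set.mem_iUnion.1 hg
      by_cases hji : j = i
      · subst hji
        simp only [Function.update_self] at hj
        rcases ih hj with h | h
        · exact .inl (.inr (Set.mem_iUnion.2 ⟨j, by simpa using h⟩))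
        · exact .inr h
      · exact .inl (.inr (Set.mem_iUnion.2 ⟨j, by simpa [hji] using hj⟩))

theorem funs_subset_funs_subst (σ : V → L.Term V) (t : L.Term V) :
    funs t ⊆ funs (t.subst σ) := by
  induction t with
  | var y => exact Set.empty_subset _
  | func f ts ih =>
    exact Set.union_subset_union_right _ (Set.iUnion_mono ih)

theorem funs_subset_of_mem_vars (σ : V → L.Term V) {x : V} {t : L.Term V} (hx : x ∈ vars t) :
    funs (σ x) ⊆ funs (t.subst σ) := by
  obtain ⟨C, hC, -⟩ := exists_fill_of_mem_vars σ hx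
  rw [hC]
  exact funs_subset_funs_fill C _

theorem mem_funs_subst {σ : V → L.Term V} {t : L.Term V} {g : Sym L}
    (hg : g ∈ funs (t.subst σ)) : g ∈ funs t ∨ ∃ x ∈ vars t, g ∈ funs (σ x) := by
  induction t with
  | var y => exact .inr ⟨y, rfl, hg⟩
  | func f ts ih =>
    rcases hg with hg | hg
    · exact .inl (.inl hg)
    · obtain ⟨i, hi⟩ := Set.mem_iUnion.1 hg
      rcases ih i hi with h | ⟨x, hx, h⟩
      · exact .inl (.inr (Set.mem_iUnion.2 ⟨i, h⟩))
      · exact .inr ⟨x, Set.mem_iUnion.2 ⟨i, hx⟩, h⟩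

theorem HasRoot.mem_funs {t : L.Term V} {f : Sym L} (h : HasRoot t f) : f ∈ funs t := by
  cases t with
  | var x => exact h.elim
  | func g ts => exact .inl h

theorem IsTRS.exists_lhs_eq {R : Set (Rule L V)} (hR : IsTRS R) {ρ : Rule L V} (hρ : ρ ∈ R) :
    ∃ (n : ℕ) (f : L.Functions n) (ts : Fin n → L.Term V), ρ.lhs = .func f ts := by
  cases h : ρ.lhs with
  | var x => exact absurd h (hR.lhs_ne_var ρ hρ x)
  | func f ts => exact ⟨_, f, ts, rfl⟩

end Terms

/-! ### Transfer of steps and normal forms to the extended signature; usable rules. -/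

section Embedding

variable {L : FirstOrder.Language.{u, v}} {V : Type w}

theorem embed_injective : Function.Injective (embed : L.Term V → (sharpLang L V).Term V) := by
  intro s
  induction s with
  | var x =>
    intro t h
    cases t with
    | var y => cases h; rfl
    | func f ts => cases h
  | func f ts ih =>
    intro t h
    cases t with
    | var y => cases h
    | func g ss =>
      obtain ⟨rfl, h1, h2⟩ := FirstOrder.Language.Term.func.inj h
      cases h1
      congr 1
      funext i
      exact ih i (congrFun (eq_of_heq h2) i)

theorem embed_subst (σ : V → L.Term V) (t : L.Term V) :
    embed (t.subst σ) = (embed t).subst fun x => embed (σ x) := by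
  induction t with
  | var x => rfl
  | func f ts ih => simp only [embed, FirstOrder.Language.Term.subst, ih]

theorem embed_update {n : ℕ} (ts : Fin n → L.Term V) (i : Fin n) (t : L.Term V) :
    (fun j => embed (Function.update ts i t j)) =
      Function.update (fun j => embed (ts j)) i (embed t) := by
  funext j
  by_cases hj : j = i
  · subst hj; simp
  · simp [hj]

theorem sharp_subst_of_ne_var (σ : V → L.Term V) {t : L.Term V} (ht : ∀ x, t ≠ .var x) :
    (sharp t).subst (fun x => embed (σ x)) = sharp (t.subst σ) := by
  cases t with
  | var x => exact absurd rfl (ht x)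
  | func f ts => simp only [sharp, FirstOrder.Language.Term.subst, embed_subst]

/-- Contexts around embedded terms. -/
def Ctx.embed : Ctx L V → Ctx (sharpLang L V) V
  | .hole => .hole
  | .arg f i ts C => .arg (L := sharpLang L V) (SharpFun.base f) i
      (fun j => TermRewriting.embed (ts j)) C.embed

theorem Ctx.embed_fill (C : Ctx L V) (t : L.Term V) :
    TermRewriting.embed (C.fill t) = C.embed.fill (TermRewriting.embed t) := by
  induction C with
  | hole => rfl
  | arg f i ts C ih => simp only [Ctx.fill, Ctx.embed, TermRewriting.embed, embed_update, ih]

/-- Embedding changes only symbols, not shape, so every position carries an embedded term. The last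
clause keeps proper subterms proper, as admissibility requires. -/
theorem exists_of_embed_eq_fill {C : Ctx (sharpLang L V) V} {s : L.Term V}
    {w : (sharpLang L V).Term V} (h : embed s = C.fill w) :
    ∃ (C' : Ctx L V) (s' : L.Term V), s = C'.fill s' ∧ w = embed s' ∧
      (C ≠ .hole → C' ≠ .hole) := by
  induction C generalizing s with
  | hole => exact ⟨.hole, s, rfl, h.symm, fun h => absurd rfl h⟩
  | arg g i ss C ih =>
    cases s with
    | var x => cases h
    | func f ts =>
      obtain ⟨rfl, -, h⟩ := FirstOrder.Language.Term.func.inj h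
      have hi : embed (ts i) = C.fill w := by
        have := congrFun (eq_of_heq h) i
        simpa using this
      obtain ⟨C', s', h1, h2, -⟩ := ih hi
      refine ⟨.arg f i ts C', s', ?_, h2, fun _ => by simp⟩
      rw [Ctx.fill, ← h1, Function.update_eq_self]

theorem exists_of_embed_eq_subst {s l : L.Term V} {σ : V → (sharpLang L V).Term V}
    (h : embed s = (embed l).subst σ) : ∃ τ : V → L.Term V, s = l.subst τ := by
  classical
  -- The default value is never used on `l`: each variable of `l` is matched with an embedded
  -- subterm of `embed s`.
  refine ⟨fun x => if hx : ∃ r, embed r = σ x then hx.choose else .var x, ?_⟩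
  induction l generalizing s with
  | var x =>
    have hx : ∃ r, embed r = σ x := ⟨s, h⟩
    have := hx.choose_spec
    simp only [FirstOrder.Language.Term.subst, dif_pos hx]
    exact embed_injective (h.trans this.symm)
  | func f ts ih =>
    cases s with
    | var x => cases h
    | func g ss =>
      obtain ⟨rfl, h1, h2⟩ := FirstOrder.Language.Term.func.inj h
      cases h1
      simp only [FirstOrder.Language.Term.subst]
      congr 1
      funext i
      exact ih i (congrFun (eq_of_heq h2) i)

/-- Pairs and embedded rules cannot rewrite more base terms than the rules themselves. -/
theorem NormalForm.embed {m : Mode} {R : Set (Rule L V)} (hR : IsTRS R)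
    {S : Set (Rule (sharpLang L V) V)} (hS : S ⊆ weakPairs m R ∪ embedRule '' R)
    {s : L.Term V} (hs : NormalForm R s) : NormalForm S (embed s) := by
  rintro t ⟨ρ, hρ, C, σ, h1, -⟩
  obtain ⟨C', s', rfl, h2, -⟩ := exists_of_embed_eq_fill h1
  rcases hS hρ with ⟨ρ', hρ', rfl⟩ | ⟨ρ', hρ', rfl⟩
  -- The left-hand side of a pair has a sharped root, which no embedded term has.
  · obtain ⟨n, f, ts, hl⟩ := hR.exists_lhs_eq hρ'
    simp only [depPair, hl, sharp, FirstOrder.Language.Term.subst] at h2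
    cases s' with
    | var x => cases h2
    | func g ss => cases h2
  · obtain ⟨τ, rfl⟩ := exists_of_embed_eq_subst h2.symm
    exact hs _ ⟨ρ', hρ', C', τ, rfl, rfl⟩

theorem Mode.Admissible.embed {m : Mode} {R : Set (Rule L V)} (hR : IsTRS R)
    {S : Set (Rule (sharpLang L V) V)} (hS : S ⊆ weakPairs m R ∪ embedRule '' R)
    {s : L.Term V} (hs : m.Admissible R s) : m.Admissible S (embed s) := by
  rintro hm u ⟨C, hC, hu⟩
  obtain ⟨C', s', rfl, rfl, h⟩ := exists_of_embed_eq_fill hu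
  exact (hs hm s' ⟨C', h hC, rfl⟩).embed hR hS

/-- Only the root of a sharped term is sharped, so its proper subterms are embedded proper subterms
of the original redex. -/
theorem Mode.Admissible.sharp {m : Mode} {R : Set (Rule L V)} (hR : IsTRS R)
    {S : Set (Rule (sharpLang L V) V)} (hS : S ⊆ weakPairs m R ∪ embedRule '' R)
    {n : ℕ} {f : L.Functions n} {ts : Fin n → L.Term V} (hs : m.Admissible R (.func f ts)) :
    m.Admissible S (sharp (.func f ts)) := by
  rintro hm u ⟨C, hC, hu⟩
  cases C with
  | hole => exact absurd rfl hC
  | arg g i ss C =>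
    obtain ⟨rfl, -, hu⟩ := FirstOrder.Language.Term.func.inj hu
    have hi : TermRewriting.embed (ts i) = C.fill u := by
      have := congrFun (eq_of_heq hu) i
      simpa using this
    obtain ⟨C', s', h1, rfl, -⟩ := exists_of_embed_eq_fill hi
    refine (hs hm s' ⟨.arg f i ts C', by simp, ?_⟩).embed hR hS
    rw [Ctx.fill, ← h1, Function.update_eq_self]

/-- The defined symbols that can show up in derivations from right-hand sides of `H`. -/
def reach (R : Set (Rule L V)) (H : Set (Rule (sharpLang L V) V)) : Set (Sym L) :=
  {g | ∃ p ∈ H, ∃ f, baseSym f ∈ funs p.rhs ∧ Relation.ReflTransGen (DependsOn R) f g}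

theorem reach_mono (R : Set (Rule L V)) {H H' : Set (Rule (sharpLang L V) V)} (h : H ⊆ H') :
    reach R H ⊆ reach R H' := fun _ ⟨p, hp, hg⟩ => ⟨p, h hp, hg⟩

/-- All defined symbols of the term have their rules in `usable R H`. -/
def Covered (R : Set (Rule L V)) (H : Set (Rule (sharpLang L V) V)) (s : L.Term V) : Prop :=
  ∀ g ∈ funs s, g ∈ defined R → g ∈ reach R H

theorem Covered.mono {R : Set (Rule L V)} {H H' : Set (Rule (sharpLang L V) V)} (h : H ⊆ H')
    {s : L.Term V} (hs : Covered R H s) : Covered R H' s :=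
  fun g hg hd => reach_mono R h (hs g hg hd)

theorem embedRule_mem_usable {R : Set (Rule L V)} {H : Set (Rule (sharpLang L V) V)}
    {ρ : Rule L V} (hρ : ρ ∈ R) {g : Sym L} (hg : HasRoot ρ.lhs g) (h : g ∈ reach R H) :
    embedRule ρ ∈ usable R H := by
  obtain ⟨p, hp, f, hf, hfg⟩ := h
  exact ⟨ρ, Set.mem_biUnion hp ⟨hρ, f, g, hf, hfg, hg⟩, rfl⟩

theorem usable_subset (R : Set (Rule L V)) (H : Set (Rule (sharpLang L V) V)) :
    usable R H ⊆ embedRule '' R := by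
  refine Set.image_mono (Set.iUnion₂_subset fun p _ => ?_)
  exact fun ρ h => h.1

theorem IsTRS.exists_hasRoot {R : Set (Rule L V)} (hR : IsTRS R) {ρ : Rule L V} (hρ : ρ ∈ R) :
    ∃ f, HasRoot ρ.lhs f := by
  obtain ⟨n, f, ts, h⟩ := hR.exists_lhs_eq hρ
  exact ⟨⟨n, f⟩, by rw [h]; rfl⟩

/-- Rewriting does not leave the covered terms. -/
theorem Covered.step {R : Set (Rule L V)} (hR : IsTRS R) {H : Set (Rule (sharpLang L V) V)}
    {s t : L.Term V} (hs : Covered R H s) (h : Step R s t) : Covered R H t := by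
  obtain ⟨ρ, hρ, C, σ, rfl, rfl⟩ := h
  intro g hg hd
  rcases funs_fill_subset C (ρ.lhs.subst σ) _ hg with hg | hg
  · exact hs g hg hd
  rcases mem_funs_subst hg with hg | ⟨x, hx, hg⟩
  -- Here `g` comes from the right-hand side of the rule: the root of the redex is reachable and
  -- depends on `g`.
  · obtain ⟨f, hf⟩ := hR.exists_hasRoot hρ
    obtain ⟨p, hp, f', hf', hff⟩ := hs f (funs_subset_funs_fill C _
      (funs_subset_funs_subst σ _ hf.mem_funs)) ⟨ρ, hρ, hf⟩
    exact ⟨p, hp, f', hf', hff.tail ⟨ρ, hρ, hf, hd, hg⟩⟩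
  · exact hs g (funs_subset_funs_fill C _
      (funs_subset_of_mem_vars σ (hR.vars_subset ρ hρ hx) hg)) hd

/-- Demanding only rules whose root occurs in `s` serves both the full system and the usable rules
of a covered term. -/
theorem Rew.embed_of_mem {m : Mode} {R : Set (Rule L V)} (hR : IsTRS R)
    {S : Set (Rule (sharpLang L V) V)} (hS : S ⊆ weakPairs m R ∪ embedRule '' R)
    {s t : L.Term V} (h : Rew m R s t)
    (hmem : ∀ ρ ∈ R, ∀ f, HasRoot ρ.lhs f → f ∈ funs s → embedRule ρ ∈ S) :
    Rew m S (embed s) (embed t) := by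
  rw [rew_iff] at h ⊢
  obtain ⟨ρ, hρ, C, σ, rfl, rfl, had⟩ := h
  obtain ⟨f, hf⟩ := hR.exists_hasRoot hρ
  refine ⟨embedRule ρ, hmem ρ hρ f hf (funs_subset_funs_fill C _
    (funs_subset_funs_subst σ _ hf.mem_funs)), C.embed, fun x => embed (σ x), ?_, ?_, ?_⟩
  · rw [C.embed_fill, embed_subst]; rfl
  · rw [C.embed_fill, embed_subst]; rfl
  · have := had.embed hR hS
    rwa [embed_subst] at this

theorem Rew.embed_all {m : Mode} {R : Set (Rule L V)} (hR : IsTRS R) {s t : L.Term V}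
    (h : Rew m R s t) : Rew m (embedRule '' R) (embed s) (embed t) :=
  h.embed_of_mem hR Set.subset_union_right fun ρ hρ _ _ _ => ⟨ρ, hρ, rfl⟩

theorem Rew.embed_usable {m : Mode} {R : Set (Rule L V)} (hR : IsTRS R)
    {Q : Set (Rule (sharpLang L V) V)} (hQ : Q ⊆ weakPairs m R) {s t : L.Term V}
    (hs : Covered R Q s) (h : Rew m R s t) :
    Rew m (Q ∪ usable R Q) (embed s) (embed t) :=
  h.embed_of_mem hR (Set.union_subset_union hQ (usable_subset R Q)) fun ρ hρ f hf hfs =>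
    .inr (embedRule_mem_usable hρ hf (hs f hfs ⟨ρ, hρ, hf⟩))

theorem stepsN_embed_usable {m : Mode} {R : Set (Rule L V)} (hR : IsTRS R)
    {Q : Set (Rule (sharpLang L V) V)} (hQ : Q ⊆ weakPairs m R) {n : ℕ} {s t : L.Term V}
    (hs : Covered R Q s) (h : StepsN (Rew m R) n s t) :
    StepsN (Rew m (Q ∪ usable R Q)) n (embed s) (embed t) := by
  induction n generalizing s with
  | zero => cases h; rfl
  | succ n ih =>
    obtain ⟨c, hc, h⟩ := h
    exact ⟨_, hc.embed_usable hR hQ hs, ih (hs.step hR hc.toStep) h⟩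

theorem Rew.sharp_arg {m : Mode} {S : Set (Rule (sharpLang L V) V)} {n : ℕ} {f : L.Functions n}
    {ts : Fin n → L.Term V} {i : Fin n} {t : L.Term V} (h : Rew m S (embed (ts i)) (embed t)) :
    Rew m S (sharp (.func f ts)) (sharp (.func f (Function.update ts i t))) := by
  simp only [sharp, embed_update]
  exact Rew.arg (L := sharpLang L V) _ (fun j => embed (ts j)) i h

end Embedding

end TermRewriting

namespace TermRewriting

/-! ### Maximal subterms, compound terms and steps with dependency pairs. -/

section Pairs

variable {L : FirstOrder.Language.{u, v}} {V : Type w}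

theorem vars_subset_of_mem_maxSubterms {m : Mode} {D : Set (Sym L)} {u t : L.Term V}
    (h : u ∈ maxSubterms m D t) : vars u ⊆ vars t := by
  induction t with
  | var x => cases m <;> simp_all [maxSubterms]
  | func f ts ih =>
    rw [maxSubterms] at h
    split_ifs at h with hf
    · rw [List.mem_singleton.1 h]
    · obtain ⟨l, hl, hu⟩ := List.mem_flatten.1 h
      obtain ⟨i, rfl⟩ := List.mem_ofFn.1 hl
      exact (ih i hu).trans (Set.subset_iUnion (fun i => vars (ts i)) i)

/-- Derivations from `t.subst σ` are made of derivations from the instances of `maxSubterms t`. -/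
theorem le_sum_maxSubterms {m : Mode} {R : Set (Rule L V)} (hR : IsTRS R) {σ : V → L.Term V}
    {N : ℕ} {g : L.Term V → ℕ}
    (hg : ∀ k ≤ N, ∀ u, (∃ b, StepsN (Rew m R) k (u.subst σ) b) → k ≤ g u) (t : L.Term V)
    (ht : m = .innermost → ∀ x ∈ vars t, NormalForm R (σ x)) {n : ℕ} (hn : n ≤ N)
    (h : ∃ b, StepsN (Rew m R) n (t.subst σ) b) :
    n ≤ ((maxSubterms m (defined R) t).map g).sum := by
  induction t generalizing n with
  | var x =>
    cases m with
    | full => simpa [maxSubterms] using hg n hn _ h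
    | innermost =>
      cases n with
      | zero => exact Nat.zero_le _
      | succ n =>
        obtain ⟨b, c, hc, -⟩ := h
        exact absurd hc (ht rfl x rfl).not_rew
  | func f ts ih =>
    rw [maxSubterms]
    split_ifs with hf
    · simpa using hg n hn _ h
    · obtain ⟨b, h⟩ := h
      obtain ⟨ks, rfl, hks⟩ := stepsN_func_split hR hf h
      rw [List.map_flatten, List.sum_flatten, List.map_ofFn, List.map_ofFn, List.sum_ofFn]
      refine Finset.sum_le_sum fun i _ => ?_
      exact ih i (fun hm x hx => ht hm x (Set.mem_iUnion.2 ⟨i, hx⟩))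
        ((Finset.single_le_sum (fun _ _ => Nat.zero_le _) (Finset.mem_univ i)).trans hn) (hks i)

theorem com_eq {l : List ((sharpLang L V).Term V)} (ρ : Rule L V) (hl : ∀ t, l ≠ [t]) :
    com ρ l = .func (L := sharpLang L V) (l := l.length) (SharpFun.compound ρ l.length) l.get := by
  match l, hl with
  | [], _ => rfl
  | [t], hl => exact absurd rfl (hl t)
  | _ :: _ :: _, _ => rfl

theorem funs_subset_funs_com (ρ : Rule L V) {l : List ((sharpLang L V).Term V)}
    {t : (sharpLang L V).Term V} (ht : t ∈ l) : funs t ⊆ funs (com ρ l) := by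
  by_cases hl : ∃ s, l = [s]
  · obtain ⟨s, rfl⟩ := hl
    rw [List.mem_singleton.1 ht]
    exact subset_rfl
  · rw [com_eq ρ (not_exists.1 hl)]
    obtain ⟨i, rfl⟩ := List.get_of_mem ht
    exact Set.subset_union_of_subset_right (Set.subset_iUnion (fun i => funs (l.get i)) i) _

/-- Lifts derivations from one component to the whole right-hand side of a pair, which is where
edges of the dependency graph start. -/
theorem exists_com_subst_eq_fill (ρ : Rule L V) {l : List ((sharpLang L V).Term V)}
    {t : (sharpLang L V).Term V} (ht : t ∈ l) (σ : V → (sharpLang L V).Term V) :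
    ∃ C : Ctx (sharpLang L V) V, (com ρ l).subst σ = C.fill (t.subst σ) := by
  by_cases hl : ∃ s, l = [s]
  · obtain ⟨s, rfl⟩ := hl
    rw [List.mem_singleton.1 ht]
    exact ⟨.hole, rfl⟩
  · rw [com_eq ρ (not_exists.1 hl)]
    obtain ⟨i, rfl⟩ := List.get_of_mem ht
    refine ⟨.arg (L := sharpLang L V) (SharpFun.compound ρ l.length) i
      (fun j => (l.get j).subst σ) .hole, ?_⟩
    simp [Ctx.fill, FirstOrder.Language.Term.subst]

/-- Distinct arguments of the compound symbol do not interfere; a single component stands without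
such a symbol. -/
theorem stepsN_com {m : Mode} {S : Set (Rule (sharpLang L V) V)} (ρ : Rule L V)
    (σ : V → (sharpLang L V).Term V) (F : L.Term V → (sharpLang L V).Term V) (k : L.Term V → ℕ)
    (us : List (L.Term V)) (h : ∀ u ∈ us, ∃ b, StepsN (Rew m S) (k u) ((F u).subst σ) b) :
    ∃ b, StepsN (Rew m S) (us.map k).sum ((com ρ (us.map F)).subst σ) b := by
  by_cases hl : ∃ u, us = [u]
  · obtain ⟨u, rfl⟩ := hl
    simpa [com] using h u (by simp)
  · rw [com_eq ρ (by
      intro t ht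
      obtain ⟨u, hu, -⟩ := List.map_eq_singleton_iff.1 ht
      exact hl ⟨u, hu⟩)]
    have hs : (us.map k).sum =
        ∑ i : Fin (us.map F).length, k (us.get (i.cast (List.length_map _))) := by
      rw [← Fin.sum_univ_fun_getElem us k]
      exact (Equiv.sum_comp (finCongr (List.length_map F)) fun i => k (us.get i)).symm
    rw [hs]
    refine stepsN_func (L := sharpLang L V) _ _ _ fun i => ?_
    have := h (us.get (i.cast (List.length_map _))) (List.get_mem _ _)
    simpa using this

theorem baseSym_mem_funs_embed {s : L.Term V} {g : Sym L} (h : g ∈ funs s) :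
    baseSym g ∈ funs (embed s) := by
  induction s with
  | var x => exact h
  | func f ts ih =>
    rcases h with rfl | h
    · exact .inl rfl
    · obtain ⟨i, hi⟩ := Set.mem_iUnion.1 h
      exact .inr (Set.mem_iUnion.2 ⟨i, ih i hi⟩)

theorem baseSym_mem_funs_sharp {n : ℕ} {f : L.Functions n} {ts : Fin n → L.Term V} {i : Fin n}
    {g : Sym L} (h : g ∈ funs (ts i)) : baseSym g ∈ funs (sharp (.func f ts)) :=
  .inr (Set.mem_iUnion.2 ⟨i, baseSym_mem_funs_embed h⟩)

theorem rew_depPair {m : Mode} {R : Set (Rule L V)} (hR : IsTRS R)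
    {S : Set (Rule (sharpLang L V) V)} (hS : S ⊆ weakPairs m R ∪ embedRule '' R) {ρ : Rule L V}
    (hρ : ρ ∈ R) (hmem : depPair m R ρ ∈ S) {σ : V → L.Term V}
    (had : m.Admissible R (ρ.lhs.subst σ)) :
    Rew m S (sharp (ρ.lhs.subst σ)) ((depPair m R ρ).rhs.subst fun x => embed (σ x)) := by
  have hl : (depPair m R ρ).lhs.subst (fun x => embed (σ x)) = sharp (ρ.lhs.subst σ) :=
    sharp_subst_of_ne_var σ (hR.lhs_ne_var ρ hρ)
  rw [rew_iff]
  refine ⟨_, hmem, .hole, fun x => embed (σ x), hl.symm, rfl, ?_⟩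
  rw [hl]
  obtain ⟨n, f, ts, h⟩ := hR.exists_lhs_eq hρ
  rw [h] at had ⊢
  exact had.sharp hR hS

end Pairs

/-! ### Paths in the congruence graph. -/

section Paths

variable {L : FirstOrder.Language.{u, v}} {V : Type w} {m : Mode} {R : Set (Rule L V)}

/-- The congruence graph has a path from a source node to `M` whose nodes have the union `Q`. -/
def PathTo (m : Mode) (R : Set (Rule L V)) (Q M : Set (Rule (sharpLang L V) V)) : Prop :=
  CongNode m R M ∧ ∃ K Ks, IsSourcePath m R K Ks ∧ Q = pathPairs (K :: Ks) ∧
    (K :: Ks).getLast (List.cons_ne_nil _ _) = M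

/-- The strongly connected component of `p`. -/
def component (m : Mode) (R : Set (Rule L V)) (p : Rule (sharpLang L V) V) :
    Set (Rule (sharpLang L V) V) :=
  {q | Relation.ReflTransGen (GraphEdge m R) p q ∧ Relation.ReflTransGen (GraphEdge m R) q p}

theorem congNode_component {p : Rule (sharpLang L V) V} (hp : p ∈ weakPairs m R) :
    CongNode m R (component m R p) := ⟨p, hp, rfl⟩

theorem mem_component_self (p : Rule (sharpLang L V) V) : p ∈ component m R p :=
  ⟨.refl, .refl⟩

theorem component_eq {p q : Rule (sharpLang L V) V} (h : q ∈ component m R p) :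
    component m R q = component m R p :=
  Set.ext fun _ => ⟨fun hx => ⟨h.1.trans hx.1, hx.2.trans h.2⟩,
    fun hx => ⟨h.2.trans hx.1, hx.2.trans h.1⟩⟩

theorem CongNode.eq_component {M : Set (Rule (sharpLang L V) V)} (hM : CongNode m R M)
    {p : Rule (sharpLang L V) V} (hp : p ∈ M) : M = component m R p := by
  obtain ⟨q, hq, rfl⟩ := hM
  exact (component_eq hp).symm

theorem mem_weakPairs_of_reflTransGen {p q : Rule (sharpLang L V) V} (hp : p ∈ weakPairs m R)
    (h : Relation.ReflTransGen (GraphEdge m R) p q) : q ∈ weakPairs m R := by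
  cases h with
  | refl => exact hp
  | tail _ h => exact h.2.1

theorem CongNode.subset_weakPairs {M : Set (Rule (sharpLang L V) V)} (hM : CongNode m R M) :
    M ⊆ weakPairs m R := by
  obtain ⟨p, hp, rfl⟩ := hM
  exact fun q hq => mem_weakPairs_of_reflTransGen hp hq.1

theorem IsSourcePath.congNode {K : Set (Rule (sharpLang L V) V)}
    {Ks : List (Set (Rule (sharpLang L V) V))} (h : IsSourcePath m R K Ks) :
    ∀ M ∈ K :: Ks, CongNode m R M := by
  obtain ⟨⟨hK, -⟩, h⟩ := h
  induction Ks generalizing K with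
  | nil => simpa using hK
  | cons M Ks ih =>
    rw [List.isChain_cons_cons] at h
    intro N hN
    rcases List.mem_cons.1 hN with rfl | hN
    · exact hK
    · exact ih h.2 h.1.2.1 N hN

theorem IsSourcePath.pathPairs_subset {K : Set (Rule (sharpLang L V) V)}
    {Ks : List (Set (Rule (sharpLang L V) V))} (h : IsSourcePath m R K Ks) :
    pathPairs (K :: Ks) ⊆ weakPairs m R := by
  rintro p ⟨M, hM, hp⟩
  exact (h.congNode M hM).subset_weakPairs hp

theorem PathTo.subset {Q M : Set (Rule (sharpLang L V) V)} (h : PathTo m R Q M) : M ⊆ Q := by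
  obtain ⟨-, K, Ks, -, rfl, rfl⟩ := h
  exact fun p hp => ⟨_, List.getLast_mem _, hp⟩

theorem PathTo.of_isSource {K : Set (Rule (sharpLang L V) V)} (h : IsSource m R K) :
    PathTo m R K K :=
  ⟨h.1, K, [], ⟨h, List.isChain_singleton K⟩, by simp [pathPairs], rfl⟩

theorem PathTo.extend {Q M N : Set (Rule (sharpLang L V) V)} (h : PathTo m R Q M)
    (hN : CongEdge m R M N) : PathTo m R (Q ∪ N) N := by
  obtain ⟨-, K, Ks, ⟨hK, hc⟩, rfl, rfl⟩ := h
  refine ⟨hN.2.1, K, Ks ++ [N], ⟨hK, ?_⟩, ?_, ?_⟩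
  · rw [← List.cons_append]
    refine hc.append (List.isChain_singleton N) ?_
    intro x hx y hy
    rw [List.getLast?_eq_getLast_of_ne_nil (List.cons_ne_nil _ _)] at hx
    cases hx
    cases hy
    exact hN
  · ext p
    simp only [pathPairs, Set.mem_union, Set.mem_ofPred_eq, List.mem_cons, List.mem_append,
      List.not_mem_nil, or_false]
    grind
  · simp

/-- A path can be prolonged along an edge of the dependency graph. -/
theorem PathTo.exists_of_edge {Q M : Set (Rule (sharpLang L V) V)} (h : PathTo m R Q M)
    {p q : Rule (sharpLang L V) V} (hp : p ∈ M) (hpq : GraphEdge m R p q) :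
    ∃ Q' M', PathTo m R Q' M' ∧ Q ⊆ Q' ∧ q ∈ M' := by
  by_cases hq : q ∈ M
  · exact ⟨Q, M, h, subset_rfl, hq⟩
  · exact ⟨_, component m R q, h.extend ⟨h.1, congNode_component hpq.2.1,
      fun e => hq (e ▸ mem_component_self q), p, hp, q, mem_component_self q, hpq⟩,
      Set.subset_union_left, mem_component_self q⟩

theorem weakPairs_finite (hR : IsTRS R) : (weakPairs m R).Finite := hR.finite.image _

/-- Every node is reachable from a source node. -/
theorem exists_pathTo (hR : IsTRS R) {q : Rule (sharpLang L V) V} (hq : q ∈ weakPairs m R) :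
    ∃ Q M, PathTo m R Q M ∧ q ∈ M := by
  -- Induction on the number of pairs that reach `q`.
  let pre (q : Rule (sharpLang L V) V) : Set (Rule (sharpLang L V) V) :=
    {p ∈ weakPairs m R | Relation.ReflTransGen (GraphEdge m R) p q}
  induction hn : (pre q).ncard using Nat.strong_induction_on generalizing q with
  | _ n ih =>
  by_cases hs : IsSource m R (component m R q)
  · exact ⟨_, _, .of_isSource hs, mem_component_self q⟩
  · simp only [IsSource, congNode_component hq, true_and, not_forall, not_not] at hs
    obtain ⟨M, hM, -, hne, p, hp, q', hq', hpq⟩ := hs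
    have hpM : M = component m R p := hM.eq_component hp
    have hpq' : Relation.ReflTransGen (GraphEdge m R) p q :=
      .head hpq hq'.2
    have hlt : (pre p).ncard < n := by
      rw [← hn]
      -- If all predecessors of `q` reached `p`, then so would `q`, and both would share a
      -- component.
      refine Set.ncard_lt_ncard ?_ ((weakPairs_finite hR).subset fun _ h => h.1)
      refine ⟨fun x hx => ⟨hx.1, hx.2.trans hpq'⟩, fun hsub => hne ?_⟩
      rw [hpM]
      exact component_eq ⟨(hsub ⟨hq, .refl⟩).2, hpq'⟩
    obtain ⟨Q, N, hQ, hpN⟩ := ih _ hlt hpq.1 rfl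
    obtain ⟨Q', M', h, -, hqM⟩ := hQ.exists_of_edge hpN hpq
    refine ⟨Q', M', h, ?_⟩
    rw [h.1.eq_component hqM, component_eq hq']
    exact mem_component_self q

/-- The unions of the nodes of paths that start in a source node. -/
def pathUnions (m : Mode) (R : Set (Rule L V)) : Set (Set (Rule (sharpLang L V) V)) :=
  {Q | ∃ K Ks, IsSourcePath m R K Ks ∧ Q = pathPairs (K :: Ks)}

theorem PathTo.mem_pathUnions {Q M : Set (Rule (sharpLang L V) V)} (h : PathTo m R Q M) :
    Q ∈ pathUnions m R := by
  obtain ⟨-, K, Ks, h, rfl, -⟩ := h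
  exact ⟨K, Ks, h, rfl⟩

theorem subset_weakPairs_of_mem_pathUnions {Q : Set (Rule (sharpLang L V) V)}
    (h : Q ∈ pathUnions m R) : Q ⊆ weakPairs m R := by
  obtain ⟨K, Ks, h, rfl⟩ := h
  exact h.pathPairs_subset

/-- Counting unions instead of paths makes finiteness immediate: they are subsets of a finite set of
pairs. -/
theorem pathUnions_finite (hR : IsTRS R) : (pathUnions m R).Finite :=
  (weakPairs_finite hR).finite_subsets.subset fun _ h => subset_weakPairs_of_mem_pathUnions h

theorem dheight_le_pathHeight {Q : Set (Rule (sharpLang L V) V)} (h : Q ∈ pathUnions m R)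
    (t : (sharpLang L V).Term V) :
    dheight (Rew m (Q ∪ usable R Q)) t ≤ pathHeight m R t := by
  obtain ⟨K, Ks, h, rfl⟩ := h
  exact le_iSup_of_le K (le_iSup_of_le Ks (le_iSup_of_le h le_rfl))

end Paths

/-! ### Distribution of a derivation over the paths. -/

section Main

variable {L : FirstOrder.Language.{u, v}} {V : Type w} {m : Mode} {R : Set (Rule L V)}

theorem sum_map_finsetSum {α β : Type*} (l : List α) (s : Finset β) (f : α → β → ℕ) :
    (l.map fun a => ∑ b ∈ s, f a b).sum = ∑ b ∈ s, (l.map fun a => f a b).sum := by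
  induction l with
  | nil => simp
  | cons a l ih => simp [ih, Finset.sum_add_distrib]

/-- Steps of terms `f(t₁, …, tₙ)` are distributed over the paths that contain a given history `H`.
The last hypothesis says that every pair that becomes applicable prolongs such a path. -/
theorem exists_simulation (hR : IsTRS R) (P : Finset (Set (Rule (sharpLang L V) V)))
    (hP : ∀ Q, Q ∈ P ↔ Q ∈ pathUnions m R) (N : ℕ) :
    ∀ (H : Set (Rule (sharpLang L V) V)) {n : ℕ} (f : L.Functions n) (ts : Fin n → L.Term V),
      (∃ b, StepsN (Rew m R) N (.func f ts) b) →
      (∀ i, Covered R H (ts i)) →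
      (∃ Q ∈ P, H ⊆ Q) →
      (∀ q ∈ weakPairs m R, ∀ τ : V → L.Term V,
        Relation.ReflTransGen (Rew m (embedRule '' R)) (sharp (.func f ts))
          (q.lhs.subst fun x => embed (τ x)) →
        ∃ Q M, PathTo m R Q M ∧ H ⊆ Q ∧ q ∈ M) →
      ∃ k : Set (Rule (sharpLang L V) V) → ℕ,
        (∀ Q ∈ P, ∃ b, StepsN (Rew m (Q ∪ usable R Q)) (k Q) (sharp (.func f ts)) b) ∧
        (∀ Q, ¬ H ⊆ Q → k Q = 0) ∧ N ≤ ∑ Q ∈ P, k Q := by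
  classical
  induction N using Nat.strong_induction_on with
  | _ N ih =>
  rintro H n f ts ⟨b, hb⟩ hcov hne hnext
  have hPw : ∀ Q ∈ P, Q ⊆ weakPairs m R := fun Q hQ =>
    subset_weakPairs_of_mem_pathUnions ((hP Q).1 hQ)
  -- One more step for every path with the required history.
  have key : ∀ (H' : Set (Rule (sharpLang L V) V)) (s : (sharpLang L V).Term V) (N' : ℕ)
      (k : Set (Rule (sharpLang L V) V) → ℕ), H ⊆ H' → (∃ Q ∈ P, H' ⊆ Q) →
      (∀ Q ∈ P, H' ⊆ Q → Rew m (Q ∪ usable R Q) (sharp (.func f ts)) s) →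
      (∀ Q ∈ P, ∃ b, StepsN (Rew m (Q ∪ usable R Q)) (k Q) s b) →
      (∀ Q, ¬ H' ⊆ Q → k Q = 0) → N' ≤ ∑ Q ∈ P, k Q →
      ∃ k : Set (Rule (sharpLang L V) V) → ℕ,
        (∀ Q ∈ P, ∃ b, StepsN (Rew m (Q ∪ usable R Q)) (k Q) (sharp (.func f ts)) b) ∧
        (∀ Q, ¬ H ⊆ Q → k Q = 0) ∧ N' + 1 ≤ ∑ Q ∈ P, k Q := by
    intro H' s N' k hH hne' hstep hk hk0 hN
    refine ⟨fun Q => if H' ⊆ Q then k Q + 1 else 0, fun Q hQ => ?_, fun Q hQ => ?_, ?_⟩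
    · dsimp only
      split_ifs with h
      · obtain ⟨b, hb⟩ := hk Q hQ
        exact ⟨b, s, hstep Q hQ h, hb⟩
      · exact ⟨_, rfl⟩
    · exact if_neg fun h => hQ (hH.trans h)
    · obtain ⟨Q, hQ, hHQ⟩ := hne'
      -- No count drops, since `k` already vanishes on the unions not containing `H'`; it grows for
      -- the one supplied by `hne'`.
      refine Nat.succ_le_of_lt (hN.trans_lt (Finset.sum_lt_sum (fun Q' _ => ?_) ⟨Q, hQ, ?_⟩))
      · split_ifs with h
        · exact Nat.le_succ _
        · exact (hk0 Q' h).le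
      · simp [hHQ]
  cases N with
  | zero => exact ⟨fun _ => 0, fun Q _ => ⟨_, rfl⟩, fun _ _ => rfl, Nat.zero_le _⟩
  | succ N =>
  obtain ⟨c, hc, hb⟩ := hb
  obtain ⟨i, t', ht', rfl⟩ | ⟨ρ, hρ, σ, h1, rfl, had⟩ := hc.func_cases
  · obtain ⟨k, hk, hk0, hN⟩ := ih N (Nat.lt_succ_self N) H f (Function.update ts i t') ⟨b, hb⟩
      (fun j => by
        by_cases hj : j = i
        · subst hj
          simpa using (hcov j).step hR ht'.toStep
        · simpa [hj] using hcov j) hne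
      (fun q hq τ h => hnext q hq τ (.head (Rew.sharp_arg (ht'.embed_all hR)) h))
    exact key H _ N k subset_rfl hne (fun Q hQ hHQ => Rew.sharp_arg
      (ht'.embed_usable hR (hPw Q hQ) ((hcov i).mono hHQ))) hk hk0 hN
  · set q := depPair m R ρ with hq
    have hqP : q ∈ weakPairs m R := ⟨ρ, hρ, rfl⟩
    have hql : q.lhs.subst (fun x => embed (σ x)) = sharp (ρ.lhs.subst σ) :=
      sharp_subst_of_ne_var σ (hR.lhs_ne_var ρ hρ)
    -- Root step: zero rewrite steps in `hnext` give a path through the history that ends in the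
    -- component of `q`.
    obtain ⟨Q₀, M₀, hQ₀, hHQ₀, hqM₀⟩ := hnext q hqP σ (by rw [hql, h1])
    set H' := insert q H with hH'
    have hH'Q₀ : H' ⊆ Q₀ := Set.insert_subset (hQ₀.subset hqM₀) hHQ₀
    have hne' : ∃ Q ∈ P, H' ⊆ Q := ⟨Q₀, (hP _).2 hQ₀.mem_pathUnions, hH'Q₀⟩
    set us := maxSubterms m (defined R) ρ.rhs with hus
    have hcovσ : ∀ x ∈ vars ρ.rhs, Covered R H' (σ x) := by
      intro x hx g hg hd
      have hx' := hR.vars_subset ρ hρ hx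
      obtain ⟨n', f', ts', hl⟩ := hR.exists_lhs_eq hρ
      rw [hl] at hx' h1
      obtain ⟨j, hj⟩ := Set.mem_iUnion.1 hx'
      obtain ⟨rfl, -, h1⟩ := FirstOrder.Language.Term.func.inj h1
      refine (hcov j).mono (Set.subset_insert q H) g ?_ hd
      rw [congrFun (eq_of_heq h1) j]
      exact funs_subset_of_mem_vars σ hj hg
    have hσ : m = .innermost → ∀ x ∈ vars ρ.rhs, NormalForm R (σ x) := by
      intro hm x hx
      obtain ⟨C, hC, hC'⟩ := exists_fill_of_mem_vars σ (hR.vars_subset ρ hρ hx)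
      exact had hm _ ⟨C, hC' (hR.lhs_ne_var ρ hρ), hC⟩
    -- The cap `N` ensures that a longest length exists even for nonterminating instances, and keeps
    -- it within reach of the induction hypothesis.
    let g : L.Term V → ℕ := fun u =>
      Nat.findGreatest (fun k => ∃ b, StepsN (Rew m R) k (u.subst σ) b) N
    have hg : ∀ u, ∃ b, StepsN (Rew m R) (g u) (u.subst σ) b := fun u =>
      Nat.findGreatest_spec (P := fun k => ∃ b, StepsN (Rew m R) k (u.subst σ) b)
        (Nat.zero_le N) ⟨_, rfl⟩
    have hgN : ∀ u, g u ≤ N := fun u => Nat.findGreatest_le N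
    have hsum : N ≤ (us.map g).sum :=
      le_sum_maxSubterms hR (fun k hk u h => Nat.le_findGreatest hk h) ρ.rhs hσ le_rfl ⟨b, hb⟩
    have hsub : ∀ u ∈ us, ∃ k : Set (Rule (sharpLang L V) V) → ℕ,
        (∀ Q ∈ P, ∃ b, StepsN (Rew m (Q ∪ usable R Q)) (k Q)
          ((sharp u).subst fun x => embed (σ x)) b) ∧
        (∀ Q, ¬ H' ⊆ Q → k Q = 0) ∧ g u ≤ ∑ Q ∈ P, k Q := by
      intro u hu
      have hvu : vars u ⊆ vars ρ.rhs := vars_subset_of_mem_maxSubterms hu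
      cases u with
      | var x =>
        -- Every path that contains `H'` can copy the whole derivation from `σ x` by usable rules,
        -- without any pairs.
        obtain ⟨b, hb⟩ := hg (.var x)
        refine ⟨fun Q => if H' ⊆ Q then g (.var x) else 0, fun Q hQ => ?_, fun Q hQ => if_neg hQ,
          ?_⟩
        · dsimp only
          split_ifs with h
          · exact ⟨_, stepsN_embed_usable hR (hPw Q hQ) ((hcovσ x (hvu rfl)).mono h) hb⟩
          · exact ⟨_, rfl⟩
        · obtain ⟨Q, hQ, hHQ⟩ := hne'
          refine le_trans (by simp [hHQ]) (Finset.single_le_sum (f := fun Q =>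
            if H' ⊆ Q then g (.var x) else 0) (fun _ _ => Nat.zero_le _) hQ)
      | func f' ss =>
        have hmem : sharp (.func f' ss) ∈ us.map sharp := List.mem_map_of_mem hu
        have hss := sharp_subst_of_ne_var σ (t := .func f' ss) (fun x => by simp)
        rw [hss]
        refine ih (g (.func f' ss)) (Nat.lt_succ_of_le (hgN _)) H' f' (fun i => (ss i).subst σ)
          (hg _) (fun i s hs hd => ?_) hne' fun q' hq' τ hτ => ?_
        · rcases mem_funs_subst hs with hs | ⟨x, hx, hs⟩
          -- The symbol occurs unsharped in the right-hand side of `q`, so it is reachable in zero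
          -- steps.
          · exact ⟨q, Set.mem_insert _ _, s, funs_subset_funs_com ρ hmem
              (baseSym_mem_funs_sharp hs), .refl⟩
          · exact hcovσ x (hvu (Set.mem_iUnion.2 ⟨i, hx⟩)) s hs hd
        · obtain ⟨C, hC⟩ := exists_com_subst_eq_fill ρ hmem fun x => embed (σ x)
          -- A pair applicable to a reduct of the component is a successor of `q`, so the path
          -- ending in `M₀` can be prolonged to it.
          have hedge : GraphEdge m R q q' := by
            refine ⟨hqP, hq', C, σ, τ, ?_⟩
            have hC' : q.rhs.subst (fun x => embed (σ x)) = _ := hC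
            rw [hC', hss]
            exact hτ.lift C.fill fun _ _ => Rew.fill C
          obtain ⟨Q', M', h, hQ', hq'M⟩ := hQ₀.exists_of_edge hqM₀ hedge
          exact ⟨Q', M', h, hH'Q₀.trans hQ', hq'M⟩
    choose! k hk hk0 hkN using hsub
    -- For each path separately, the lengths of the components are added.
    refine key H' (q.rhs.subst fun x => embed (σ x)) N (fun Q => (us.map fun u => k u Q).sum)
      (Set.subset_insert q H) hne' (fun Q hQ hHQ => ?_) (fun Q hQ => ?_) (fun Q hQ => ?_) ?_
    · rw [h1]
      exact rew_depPair hR (Set.union_subset_union (hPw Q hQ) (usable_subset R Q)) hρ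
        (.inl (hHQ (Set.mem_insert q H))) had
    · exact stepsN_com ρ _ sharp (fun u => k u Q) us fun u hu => hk u hu Q hQ
    · refine List.sum_eq_zero fun x hx => ?_
      obtain ⟨u, hu, rfl⟩ := List.mem_map.1 hx
      exact hk0 u hu Q hQ
    · rw [← sum_map_finsetSum]
      exact hsum.trans (List.sum_le_sum hkN)

end Main

end TermRewriting

theorem theoremt {L : FirstOrder.Language.{u, v}} {V : Type w}
    (m : TermRewriting.Mode) (R : Set (TermRewriting.Rule L V)) (hR : TermRewriting.IsTRS R) :
    ∃ c : ℕ, ∀ t : L.Term V, TermRewriting.IsBasic R t →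
      TermRewriting.dheight (TermRewriting.Rew m R) t ≤
        (c : ℕ∞) * TermRewriting.pathHeight m R (TermRewriting.sharp t) := by
  open TermRewriting in
  have hfin := pathUnions_finite (m := m) hR
  refine ⟨hfin.toFinset.card, fun t ht => iSup₂_le fun n hn => ?_⟩
  cases t with
  | var x => exact ht.elim
  | func f ts =>
    obtain ⟨⟨ρ, hρ, -⟩, hts⟩ := ht
    -- The defined root of `t` supplies a rule, so there is at least one path. The history starts
    -- empty: the arguments contain no defined symbols, and every pair lies on a path from a source.
    obtain ⟨Q₀, M₀, hQ₀, -⟩ := exists_pathTo hR (m := m) ⟨ρ, hρ, rfl⟩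
    obtain ⟨k, hk, -, hsum⟩ := exists_simulation hR hfin.toFinset (fun Q => hfin.mem_toFinset) n ∅ f
      ts hn (fun i g hg hd => absurd hd (hts i g hg))
      ⟨Q₀, hfin.mem_toFinset.2 hQ₀.mem_pathUnions, Set.empty_subset _⟩
      fun q hq _ _ => by
        obtain ⟨Q, M, h, hqM⟩ := exists_pathTo hR hq
        exact ⟨Q, M, h, Set.empty_subset _, hqM⟩
    calc (n : ℕ∞) ≤ ((∑ Q ∈ hfin.toFinset, k Q : ℕ) : ℕ∞) := by exact_mod_cast hsum
      _ = ∑ Q ∈ hfin.toFinset, (k Q : ℕ∞) := Nat.cast_sum _ _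
      _ ≤ ∑ _Q ∈ hfin.toFinset, pathHeight m R (sharp (.func f ts)) := by
        refine Finset.sum_le_sum fun Q hQ => ?_
        obtain ⟨b, hb⟩ := hk Q hQ
        exact hb.le_dheight.trans (dheight_le_pathHeight (hfin.mem_toFinset.1 hQ) _)
      _ = _ := by rw [Finset.sum_const, nsmul_eq_mul]
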